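/- Consider bandits with fixed expert advice. There are $K$ arms and a known finite set $\Theta$ of $N$ policies, i.e. probability distributions on the arms. The losses are an unknown sequence of vectors $\ell_1,\dots,\ell_T\in[0,1]^K$. At each round $t\le T$ the algorithm picks, possibly at random and depending on the past policies, arms and observed losses, a policy $\theta_t\in\Theta$; an arm $A_t\sim\theta_t$ is drawn, and the algorithm observes $A_t$ and $\ell_t(A_t)$. Writing $\ell_t(\theta)=\sum_j\theta(j)\ell_t(j)$, its regret against this sequence is $$R_T=\mathbb{E}\sum_{t=1}^T \ell_t(\theta_t)-\min_{\theta\in\Theta}\sum_{t=1}^T\ell_t(\theta).$$ Let $$\mathcal S^*(\Theta)=\sum_{j}\Big(\max_{\theta\in\Theta}\theta(j)-\min_{\theta\in\Theta}\theta(j)\Big),\qquad D^*(\Theta)=\min_{\tau}\max_{\theta\in\Theta}D(\theta,\tau),$$ where $\tau$ ranges over all probability distributions on the arms and $D$ is the Kullback–Leibler divergence. Let $q\ge 2$ and $M\ge 1$ be integers. Take $K=qM$ arms divided into $M$ sections of $q$ arms each, and let $\Theta$ be the set of all uniform distributions over $M$ arms that give every section mass $1/M$ (equivalently, that are uniform over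 a choice of one arm from each section). Then $K\ge 2$, every arm is in the support of some policy, $N=q^M$, $\mathcal S^*(\Theta)=q$, the minimum defining $D^*(\Theta)$ is attained, $D^*(\Theta)=\log q$, and $\mathcal S^*(\Theta)\log N=K\,D^*(\Theta)$. Moreover, for every integer $T\ge \frac{K}{4\log(4/3)}$ and every algorithm (which may depend on $T$), there is a sequence of losses such that $$R_T\ \ge\ \frac1{18}\sqrt{KT}\qquad\text{and}\qquad R_T\ \ge\ \frac1{18}\sqrt{\mathcal S^*(\Theta)\,T\,\frac{\log N}{\log \mathcal S^*(\Theta)}} .$$ -/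

import Mathlib

open scoped ENNReal

noncomputable section

namespace FixedExperts

/-! Bandits with fixed expert advice. `A` is the finite set of arms, a policy is a probability
distribution on `A`, and the player is given a finite set `Θ` of policies. -/

/-- The similarity index `∑ⱼ (max_θ θ(j) - min_θ θ(j))` of a policy set. -/
def SStar {A : Type*} [Fintype A] (Θ : Finset (PMF A)) : ℝ :=
  ∑ a, ((⨆ θ : Θ, (θ.1 a).toReal) - (⨅ θ : Θ, (θ.1 a).toReal))

/-- `D(Θ ‖ τ)`, the largest Kullback-Leibler divergence from a policy of `Θ` to `τ`. -/
def maxKL {A : Type*} [MeasurableSpace A] (Θ : Finset (PMF A)) (τ : PMF A) : ℝ≥0∞ :=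
  ⨆ θ ∈ Θ, InformationTheory.klDiv θ.toMeasure τ.toMeasure

/-- The KL width of a policy set, `D*(Θ) = min_τ D(Θ ‖ τ)` over all distributions `τ` on arms. -/
def DStar {A : Type*} [MeasurableSpace A] (Θ : Finset (PMF A)) : ℝ≥0∞ :=
  ⨅ τ : PMF A, maxKL Θ τ

/-- A (randomized) algorithm of the player: at round `t` (rounds are numbered from `0`) it maps
the past `(θ_s, A_s, ℓ_s(A_s))_{s < t}` to a distribution on `Θ`, from which the next policy is
drawn. -/
abbrev Strategy {A : Type*} (Θ : Finset (PMF A)) : Type _ :=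
  (t : ℕ) → (Fin t → Θ × A × ℝ) → PMF Θ

/-- The information available after the policies and arms `(θ_s, A_s)_{s < t}` were played against
the loss sequence `ℓ` : only the losses of the played arms are observed. -/
def observed {A : Type*} {Θ : Finset (PMF A)} (ℓ : ℕ → A → ℝ) {t : ℕ} (ω : Fin t → Θ × A) :
    Fin t → Θ × A × ℝ :=
  fun s => ((ω s).1, (ω s).2, ℓ s (ω s).2)

/-- The law of `(θ_s, A_s)_{s < t}` when `π` is run against `ℓ` : given the past, the policy is
drawn from `π`, and then the arm is drawn from the policy. -/
def playLaw {A : Type*} {Θ : Finset (PMF A)} (π : Strategy Θ) (ℓ : ℕ → A → ℝ) :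
    (t : ℕ) → PMF (Fin t → Θ × A)
  | 0 => PMF.pure Fin.elim0
  | t + 1 => (playLaw π ℓ t).bind fun ω =>
      (π t (observed ℓ ω)).bind fun θ =>
        θ.1.bind fun a => PMF.pure (Fin.snoc (α := fun _ => Θ × A) ω (θ, a))

/-- The expected loss `ℓ(θ) = ∑ⱼ θ(j) ℓ(j)` of a policy. -/
def policyLoss {A : Type*} [Fintype A] (l : A → ℝ) (θ : PMF A) : ℝ :=
  ∑ a, (θ a).toReal * l a

/-- The regret `R_T = 𝔼 ∑_{t < T} ℓ_t(θ_t) - min_θ ∑_{t < T} ℓ_t(θ)` of the algorithm `π` against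
the loss sequence `ℓ`. -/
def regret {A : Type*} [Fintype A] {Θ : Finset (PMF A)} (π : Strategy Θ) (ℓ : ℕ → A → ℝ)
    (T : ℕ) : ℝ :=
  (∑ ω : Fin T → Θ × A, (playLaw π ℓ T ω).toReal * ∑ t : Fin T, policyLoss (ℓ t) (ω t).1.1)
    - ⨅ θ : Θ, ∑ t : Fin T, policyLoss (ℓ t) θ.1

open Classical in
/-- The set of all uniform distributions over exactly `M` of the arms. -/
def uniformPolicies (A : Type*) [Fintype A] (M : ℕ) : Finset (PMF A) :=
  Finset.univ.image fun S : {S : Finset A // S.Nonempty ∧ S.card = M} =>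
    PMF.uniformOfFinset S.1 S.2.1

open Classical in
/-- The multi-task policy set. The arms are the pairs `(i, j)` of a section `i` (there are `M`)
and a position `j` in the section (there are `q`); the policies are all uniform distributions over
`M` arms that give each section the mass `1 / M`, that is, whose support has exactly one arm in
each section. -/
def multiTaskPolicies (M q : ℕ) : Finset (PMF (Fin M × Fin q)) :=
  (uniformPolicies (Fin M × Fin q) M).filter fun θ => ∀ i, ∑ j, θ (i, j) = (M : ℝ≥0∞)⁻¹

end FixedExperts

end

namespace FixedExperts


/-! The lower bound hides one good arm `σ i` in each section `i`: good arms have mean loss `1/2 -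
ε`, all others `1/2`. The policy on the graph of `σ` gains `ε` per round, and any other policy gains
only `ε` times its mass on good arms. To bound that mass in section `i`, remove the good arm of this
section. Every policy gives the section mass `1/M`, so under this reference law about `T/M` of the
plays fall there, spread over `q` positions, whatever the algorithm does. Restoring a good arm
changes the mean of a `[0,1]`-valued statistic by at most the root of half the divergence
(`sum_ratio_le_add_sqrt`, `sum_histLaw_update_le`). Averaging over its position
(`sum_update_weight_le`) and then over `σ` (`exists_gap_le_regret`) shows that for `ε` of order
`√(K/T)` a constant fraction of `ε T` is lost, hence regret of order `√(KT)`. `exists_le_regret`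
turns the stochastic bound into a fixed loss sequence.

The width is `log q`: the uniform distribution is at that distance from every policy, and against
any `τ` the policy taking the least likely arm of each section is at least as far. As `S* = q` and
`N = q ^ M`, both regret bounds are the same number. -/

/-! ### A finite Pinsker inequality -/

/-- The rational lower bound for `x - 1 - log x` behind Pinsker's inequality. -/
theorem sq_sub_one_div_le_sub_one_sub_log {x : ℝ} (hx : 0 < x) :
    3 * (x - 1) ^ 2 / (2 + 4 * x) ≤ x - 1 - Real.log x := by
  set u : ℝ → ℝ := fun x => x - 1 - Real.log x - 3 * (x - 1) ^ 2 / (2 + 4 * x) with hu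
  -- The derivative has the sign of `y - 1`, so `u` is minimal at `1`, where it vanishes.
  have hder : ∀ y : ℝ, 0 < y → HasDerivAt u ((y - 1) ^ 3 / (y * (1 + 2 * y) ^ 2)) y := by
    intro y hy
    have h1 : HasDerivAt (fun x : ℝ => x - 1) 1 y := (hasDerivAt_id y).sub_const 1
    have h2 : HasDerivAt (fun x : ℝ => 2 + 4 * x) 4 y := by
      simpa using ((hasDerivAt_id y).const_mul 4).const_add 2
    have h3 := ((h1.pow 2).const_mul 3).div h2 (by positivity)
    refine ((h1.sub (Real.hasDerivAt_log hy.ne')).sub h3).congr_deriv ?_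
    have h4 : (2 + 4 * y) ≠ 0 := by positivity
    have h5 : (1 + 2 * y) ≠ 0 := by positivity
    simp only [Pi.pow_apply]
    rw [show 2 + 4 * y = 2 * (1 + 2 * y) by ring]
    field_simp
    ring
  have hcont : ∀ s : Set ℝ, s ⊆ Set.Ioi 0 → ContinuousOn u s := fun s hs y hy =>
    (hder y (hs hy)).continuousAt.continuousWithinAt
  have h1 : u 1 = 0 := by simp [hu]
  suffices 0 ≤ u x by simp only [hu] at this; linarith
  rcases le_total x 1 with h | h
  · have hanti : AntitoneOn u (Set.Icc x 1) := by
      refine antitoneOn_of_deriv_nonpos (convex_Icc x 1)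
        (hcont _ fun y hy => lt_of_lt_of_le hx hy.1) ?_ ?_
      · intro y hy
        rw [interior_Icc] at hy
        exact (hder y (hx.trans hy.1)).differentiableAt.differentiableWithinAt
      · intro y hy
        rw [interior_Icc] at hy
        rw [(hder y (hx.trans hy.1)).deriv]
        have := hx.trans hy.1
        refine div_nonpos_of_nonpos_of_nonneg ?_ (by positivity)
        exact (Odd.pow_nonpos (by decide) (by linarith [hy.2]))
    rw [← h1]
    exact hanti ⟨le_rfl, h⟩ ⟨h, le_rfl⟩ h
  · have hmono : MonotoneOn u (Set.Icc 1 x) := by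
      refine monotoneOn_of_deriv_nonneg (convex_Icc 1 x)
        (hcont _ fun y hy => lt_of_lt_of_le one_pos hy.1) ?_ ?_
      · intro y hy
        rw [interior_Icc] at hy
        exact (hder y (one_pos.trans hy.1)).differentiableAt.differentiableWithinAt
      · intro y hy
        rw [interior_Icc] at hy
        rw [(hder y (one_pos.trans hy.1)).deriv]
        have h2 : 0 ≤ y - 1 := by linarith [hy.1]
        have := one_pos.trans hy.1
        positivity
    rw [← h1]
    exact hmono ⟨le_rfl, h⟩ ⟨h, le_rfl⟩ h

/-- Pinsker's inequality on a finite type, for a `[0, 1]`-valued function and two probability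
vectors with a positive likelihood ratio `r`. -/
theorem sum_ratio_le_add_sqrt {ι : Type*} [Fintype ι] (P r f : ι → ℝ) (hP : ∀ i, 0 ≤ P i)
    (hP1 : ∑ i, P i = 1) (hr : ∀ i, 0 < r i) (hr1 : ∑ i, P i * r i = 1)
    (hf : ∀ i, f i ∈ Set.Icc (0 : ℝ) 1) :
    ∑ i, P i * r i * f i ≤ ∑ i, P i * f i + √(1 / 2 * ∑ i, P i * -Real.log (r i)) := by
  have hlog : ∀ i, 0 ≤ r i - 1 - Real.log (r i) := fun i => by
    linarith [Real.log_le_sub_one_of_pos (hr i)]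
  -- Cauchy–Schwarz: the first factor has `P`-mean `2` because `r` has mean `1`, and the second has
  -- the divergence as its mean.
  have hCS := Finset.sum_sq_le_sum_mul_sum_of_sq_le_mul Finset.univ
    (r := fun i => P i * |r i - 1|)
    (f := fun i => P i * ((2 + 4 * r i) / 3)) (g := fun i => P i * (r i - 1 - Real.log (r i)))
    (fun i _ => mul_nonneg (hP i) (by linarith [hr i]))
    (fun i _ => mul_nonneg (hP i) (hlog i)) (fun i _ => by
      have h := sq_sub_one_div_le_sub_one_sub_log (hr i)
      rw [div_le_iff₀ (by linarith [hr i])] at h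
      rw [mul_pow, sq_abs]
      nlinarith [mul_le_mul_of_nonneg_left h (sq_nonneg (P i))])
  have e1 : ∑ i, P i * ((2 + 4 * r i) / 3) = 2 := by
    have : ∀ i, P i * ((2 + 4 * r i) / 3) = 2 / 3 * P i + 4 / 3 * (P i * r i) := fun i => by ring
    simp only [this, Finset.sum_add_distrib, ← Finset.mul_sum, hP1, hr1]
    norm_num
  have e2 : ∑ i, P i * (r i - 1 - Real.log (r i)) = ∑ i, P i * -Real.log (r i) := by
    have : ∀ i, P i * (r i - 1 - Real.log (r i)) = P i * r i - P i + P i * -Real.log (r i) :=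
      fun i => by ring
    simp only [this, Finset.sum_add_distrib, Finset.sum_sub_distrib, hP1, hr1]
    ring
  rw [e1, e2] at hCS
  have hdiff : ∑ i, P i * r i * f i - ∑ i, P i * f i ≤ 1 / 2 * ∑ i, P i * |r i - 1| := by
    -- Centring `f` at `1/2` is free since `r - 1` has mean `0`; it gains the factor `1/2`.
    have h0 : ∑ i, P i * (r i - 1) * (1 / 2) = 0 := by
      rw [← Finset.sum_mul]
      simp [mul_sub, hP1, hr1]
    have h1 : ∑ i, P i * r i * f i - ∑ i, P i * f i = ∑ i, P i * (r i - 1) * (f i - 1 / 2) := by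
      simp only [mul_sub, Finset.sum_sub_distrib] at h0 ⊢
      rw [← Finset.sum_sub_distrib, h0, sub_zero]
      exact Finset.sum_congr rfl fun i _ => by ring
    rw [h1, Finset.mul_sum]
    refine Finset.sum_le_sum fun i _ => ?_
    have h2 : (r i - 1) * (f i - 1 / 2) ≤ |r i - 1| * (1 / 2) := by
      refine (le_abs_self _).trans ?_
      rw [abs_mul]
      refine mul_le_mul_of_nonneg_left ?_ (abs_nonneg _)
      rw [abs_le]
      constructor <;> linarith [(hf i).1, (hf i).2]
    nlinarith [mul_le_mul_of_nonneg_left h2 (hP i)]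
  have hfin : 1 / 2 * ∑ i, P i * |r i - 1| ≤ √(1 / 2 * ∑ i, P i * -Real.log (r i)) := by
    refine Real.le_sqrt_of_sq_le ?_
    nlinarith
  linarith

/-! ### Laws of finite histories -/

theorem sum_fin_snoc {Y E : Type*} [Fintype Y] [AddCommMonoid E] {t : ℕ}
    (F : (Fin (t + 1) → Y) → E) :
    ∑ h, F h = ∑ h : Fin t → Y, ∑ y, F (Fin.snoc (α := fun _ => Y) h y) := by
  rw [Finset.sum_comm, ← Fintype.sum_prod_type' (f := fun y h => F (Fin.snoc (α := fun _ => Y) h y))]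
  exact (Fintype.sum_equiv (Fin.snocEquiv fun _ => Y) _ _ fun _ => rfl).symm

/-- The weight of a history of length `t` when the next outcome is drawn from the weights
`κ t h` given the past `h`. -/
noncomputable def histLaw {Y : Type*} (κ : (t : ℕ) → (Fin t → Y) → Y → ℝ) :
    (t : ℕ) → (Fin t → Y) → ℝ
  | 0, _ => 1
  | t + 1, h => histLaw κ t (Fin.init h) * κ t (Fin.init h) (h (Fin.last t))

section histLaw

variable {Y Z : Type*} {κ : (t : ℕ) → (Fin t → Y) → Y → ℝ}

@[simp]
theorem histLaw_zero (h : Fin 0 → Y) : histLaw κ 0 h = 1 := rfl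

@[simp]
theorem histLaw_snoc {t : ℕ} (h : Fin t → Y) (y : Y) :
    histLaw κ (t + 1) (Fin.snoc (α := fun _ => Y) h y) = histLaw κ t h * κ t h y := by
  simp [histLaw]

theorem histLaw_nonneg (hκ : ∀ t h y, 0 ≤ κ t h y) : ∀ t h, 0 ≤ histLaw κ t h
  | 0, _ => zero_le_one
  | t + 1, _ => mul_nonneg (histLaw_nonneg hκ t _) (hκ _ _ _)

/-- The likelihood ratio of two environments is a product over rounds, so its logarithm is an
additive functional of the history. -/
theorem histLaw_mul_ratio (r : Y → ℝ) :
    ∀ t h, histLaw (fun t h y => κ t h y * r y) t h = histLaw κ t h * ∏ s, r (h s)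
  | 0, _ => by simp
  | t + 1, h => by
    rw [histLaw, histLaw_mul_ratio r t, Fin.prod_univ_castSucc, histLaw]
    simp only [Fin.init]
    ring

variable [Fintype Y] [Fintype Z]

theorem sum_histLaw (hκ : ∀ t h, ∑ y, κ t h y = 1) : ∀ t, ∑ h, histLaw κ t h = 1
  | 0 => by simp
  | t + 1 => by
    rw [sum_fin_snoc]
    simp [← Finset.mul_sum, hκ, sum_histLaw hκ t]

/-- Additive functionals of the history with the same conditional means have the same mean. -/
theorem sum_histLaw_mul_sum_congr (hκ : ∀ t h, ∑ y, κ t h y = 1) {g g' : Y → ℝ}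
    (hg : ∀ t h, ∑ y, κ t h y * g y = ∑ y, κ t h y * g' y) :
    ∀ t, ∑ h, histLaw κ t h * ∑ s, g (h s) = ∑ h, histLaw κ t h * ∑ s, g' (h s)
  | 0 => by simp
  | t + 1 => by
    have key : ∀ g : Y → ℝ, ∑ h, histLaw κ (t + 1) h * ∑ s, g (h s) =
        ∑ h, histLaw κ t h * ∑ s, g (h s) + ∑ h, histLaw κ t h * ∑ y, κ t h y * g y := by
      intro g
      rw [sum_fin_snoc, ← Finset.sum_add_distrib]
      refine Finset.sum_congr rfl fun h _ => ?_
      simp only [histLaw_snoc, Fin.sum_univ_castSucc, Fin.snoc_castSucc, Fin.snoc_last, mul_add,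
        Finset.sum_add_distrib, Finset.mul_sum, mul_assoc]
      congr 1
      rw [Finset.sum_comm]
      refine Finset.sum_congr rfl fun s _ => ?_
      rw [← Finset.mul_sum, ← Finset.sum_mul, hκ, one_mul]
    rw [key, key, sum_histLaw_mul_sum_congr hκ hg t]
    simp only [hg]

/-- Histories may be mapped letter by letter if the step weights are mapped. -/
theorem sum_histLaw_map {κ' : (t : ℕ) → (Fin t → Z) → Z → ℝ} (φ : Y → Z)
    (hκ : ∀ t h (G : Z → ℝ), ∑ y, κ t h y * G (φ y) = ∑ z, κ' t (fun s => φ (h s)) z * G z) :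
    ∀ t (F : (Fin t → Z) → ℝ),
      ∑ h, histLaw κ t h * F (fun s => φ (h s)) = ∑ h, histLaw κ' t h * F h
  | 0, F => by
    simp only [histLaw_zero, one_mul, Finset.univ_unique, Finset.sum_singleton]
    exact congrArg F (Subsingleton.elim _ _)
  | t + 1, F => by
    rw [sum_fin_snoc, sum_fin_snoc]
    have := sum_histLaw_map φ hκ t
      (fun h => ∑ z, κ' t h z * F (Fin.snoc (α := fun _ => Z) h z))
    simp only [histLaw_snoc, mul_assoc, ← Finset.mul_sum]
    rw [← this]
    refine Finset.sum_congr rfl fun h _ => ?_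
    rw [← hκ t h fun z => F (Fin.snoc (α := fun _ => Z) (fun s => φ (h s)) z)]
    congr 1
    refine Finset.sum_congr rfl fun y _ => ?_
    congr 2
    funext s
    refine Fin.lastCases ?_ (fun s => ?_) s <;> simp

end histLaw


/-! ### Bandit play against random loss vectors, and derandomization -/

theorem pmf_sum_toReal {X : Type*} [Fintype X] (p : PMF X) : ∑ x, (p x).toReal = 1 := by
  rw [← ENNReal.toReal_sum fun x _ => p.apply_ne_top x, ← tsum_fintype (L := .unconditional _), p.tsum_coe,
    ENNReal.toReal_one]

/-- The weight of a binary outcome whose mean is `x`. -/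
noncomputable def bern (x : ℝ) (b : Bool) : ℝ := if b then x else 1 - x

/-- A binary loss as a real number. -/
noncomputable def lossOf (b : Bool) : ℝ := if b then 1 else 0

theorem lossOf_mem_Icc (b : Bool) : lossOf b ∈ Set.Icc (0 : ℝ) 1 := by
  cases b <;> simp [lossOf]

section play

variable {A R : Type*} {Θ : Finset (PMF A)}

/-- The step weights of the policy, the arm and the binary loss of the arm when `π` is run in a
stochastic environment with mean losses `μ`. -/
noncomputable def banditStep (π : Strategy Θ) (μ : A → ℝ) (t : ℕ) (h : Fin t → Θ × A × Bool)
    (y : Θ × A × Bool) : ℝ :=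
  (π t (fun s => ((h s).1, (h s).2.1, lossOf (h s).2.2)) y.1).toReal * (y.1.1 y.2.1).toReal *
    bern (μ y.2.1) y.2.2

/-- The step weights of the policy, the arm and the index of the loss vector when `π` is run
against independent loss vectors `val r`, where `r` has the weight `ρ r`. -/
noncomputable def rowStep (π : Strategy Θ) (val : R → A → Bool) (ρ : R → ℝ) (t : ℕ)
    (h : Fin t → Θ × A × R) (y : Θ × A × R) : ℝ :=
  (π t (fun s => ((h s).1, (h s).2.1, lossOf (val (h s).2.2 (h s).2.1))) y.1).toReal *
    (y.1.1 y.2.1).toReal * ρ y.2.2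

/-- A history determines its past, its last policy and its last arm, so each of the three sums from
`bind` has a single nonzero term. -/
theorem playLaw_succ_toReal (π : Strategy Θ) (ℓ : ℕ → A → ℝ) (t : ℕ)
    (ω : Fin (t + 1) → Θ × A) :
    (playLaw π ℓ (t + 1) ω).toReal = (playLaw π ℓ t (Fin.init ω)).toReal *
      ((π t (observed ℓ (Fin.init ω)) (ω (Fin.last t)).1).toReal *
        ((ω (Fin.last t)).1.1 (ω (Fin.last t)).2).toReal) := by
  rw [← ENNReal.toReal_mul, ← ENNReal.toReal_mul]
  congr 1
  simp only [playLaw, PMF.bind_apply]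
  rw [tsum_eq_single (Fin.init ω), tsum_eq_single (ω (Fin.last t)).1,
    tsum_eq_single (ω (Fin.last t)).2]
  · rw [PMF.pure_apply, if_pos, mul_one]
    exact (Fin.snoc_init_self (α := fun _ => Θ × A) ω).symm
  · intro a ha
    rw [PMF.pure_apply, if_neg, mul_zero]
    intro hω
    exact ha (by rw [hω]; simp)
  · intro θ hθ
    refine mul_eq_zero_of_right _ (ENNReal.tsum_eq_zero.2 fun a => ?_)
    rw [PMF.pure_apply, if_neg, mul_zero]
    intro hω
    exact hθ (by rw [hω]; simp)
  · intro ω' hω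
    refine mul_eq_zero_of_right _ (ENNReal.tsum_eq_zero.2 fun θ => ?_)
    refine mul_eq_zero_of_right _ (ENNReal.tsum_eq_zero.2 fun a => ?_)
    rw [PMF.pure_apply, if_neg, mul_zero]
    rintro rfl
    simp at hω

/-- Playing against independent random loss vectors, jointly with the loss vectors. -/
theorem histLaw_rowStep (π : Strategy Θ) (val : R → A → Bool) (ρ : R → ℝ)
    (ℓ : ℕ → A → ℝ) : ∀ (t : ℕ) (h : Fin t → Θ × A × R),
    (∀ (s : Fin t) a, ℓ s a = lossOf (val (h s).2.2 a)) →
    histLaw (rowStep π val ρ) t h =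
      (∏ s, ρ (h s).2.2) * (playLaw π ℓ t fun s => ((h s).1, (h s).2.1)).toReal
  | 0, h, _ => by
    have : (fun s => ((h s).1, (h s).2.1)) = (Fin.elim0 : Fin 0 → Θ × A) := Subsingleton.elim _ _
    simp [playLaw, this]
  | t + 1, h, hℓ => by
    have ih := histLaw_rowStep π val ρ ℓ t (Fin.init h) fun s a => hℓ s.castSucc a
    rw [histLaw, ih, playLaw_succ_toReal, Fin.prod_univ_castSucc]
    have e : observed ℓ (Fin.init fun s => ((h s).1, (h s).2.1)) =
        fun s => ((Fin.init h s).1, (Fin.init h s).2.1,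
          lossOf (val (Fin.init h s).2.2 (Fin.init h s).2.1)) := by
      funext s
      simp only [observed, Fin.init]
      rw [← hℓ s.castSucc]
      rfl
    rw [e]
    simp only [rowStep]
    change _ * (playLaw π ℓ t (Fin.init fun s => ((h s).1, (h s).2.1))).toReal * _ = _
    simp only [Fin.init]
    ring

theorem banditStep_nonneg (π : Strategy Θ) {μ : A → ℝ} (hμ : ∀ a, μ a ∈ Set.Icc (0 : ℝ) 1) (t : ℕ)
    (h : Fin t → Θ × A × Bool) (y : Θ × A × Bool) : 0 ≤ banditStep π μ t h y := by
  refine mul_nonneg (by positivity) ?_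
  have := hμ y.2.1
  rw [bern]
  split_ifs
  · exact this.1
  · linarith [this.2]

/-- The loss sequence with the loss vectors `val (L t)` up to the horizon. -/
noncomputable def lossSeq (val : R → A → Bool) {T : ℕ} (L : Fin T → R) : ℕ → A → ℝ :=
  fun s a => if h : s < T then lossOf (val (L ⟨s, h⟩) a) else 0

theorem lossSeq_mem_Icc (val : R → A → Bool) {T : ℕ} (L : Fin T → R) (t : ℕ) (a : A) :
    lossSeq val L t a ∈ Set.Icc (0 : ℝ) 1 := by
  unfold lossSeq
  split_ifs
  · exact lossOf_mem_Icc _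
  · simp

theorem lossSeq_coe (val : R → A → Bool) {T : ℕ} (L : Fin T → R) (t : Fin T) :
    lossSeq val L t = fun a => lossOf (val (L t) a) := by
  funext a
  simp [lossSeq]

variable [Fintype A] [Fintype R]

theorem sum_banditStep_mul (π : Strategy Θ) (μ : A → ℝ) (t : ℕ) (h : Fin t → Θ × A × Bool)
    (g : Θ × A × Bool → ℝ) :
    ∑ y, banditStep π μ t h y * g y =
      ∑ θ, (π t (fun s => ((h s).1, (h s).2.1, lossOf (h s).2.2)) θ).toReal *
        ∑ a, (θ.1 a).toReal * (μ a * g (θ, a, true) + (1 - μ a) * g (θ, a, false)) := by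
  simp only [Fintype.sum_prod_type, Finset.mul_sum]
  refine Finset.sum_congr rfl fun θ _ => Finset.sum_congr rfl fun a _ => ?_
  simp [banditStep, bern]
  ring

theorem sum_rowStep_mul (π : Strategy Θ) (val : R → A → Bool) (ρ : R → ℝ) (t : ℕ)
    (h : Fin t → Θ × A × R) (g : Θ × A × R → ℝ) :
    ∑ y, rowStep π val ρ t h y * g y =
      ∑ θ, (π t (fun s => ((h s).1, (h s).2.1, lossOf (val (h s).2.2 (h s).2.1))) θ).toReal *
        ∑ a, (θ.1 a).toReal * ∑ r, ρ r * g (θ, a, r) := by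
  simp only [Fintype.sum_prod_type, Finset.mul_sum]
  refine Finset.sum_congr rfl fun θ _ => Finset.sum_congr rfl fun a _ =>
    Finset.sum_congr rfl fun r _ => ?_
  simp only [rowStep]
  ring

theorem sum_banditStep (π : Strategy Θ) (μ : A → ℝ) (t : ℕ) (h : Fin t → Θ × A × Bool) :
    ∑ y, banditStep π μ t h y = 1 := by
  have := sum_banditStep_mul π μ t h fun _ => 1
  simp only [mul_one] at this
  rw [this]
  simp only [add_sub_cancel, mul_one, pmf_sum_toReal]

theorem sum_rowStep (π : Strategy Θ) (val : R → A → Bool) {ρ : R → ℝ} (hρ : ∑ r, ρ r = 1)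
    (t : ℕ) (h : Fin t → Θ × A × R) : ∑ y, rowStep π val ρ t h y = 1 := by
  have := sum_rowStep_mul π val ρ t h fun _ => 1
  simp only [mul_one] at this
  rw [this]
  simp only [hρ, mul_one, pmf_sum_toReal]

/-- Only the marginals of the loss vectors matter for what the player sees. -/
theorem sum_histLaw_rowStep_map (π : Strategy Θ) (val : R → A → Bool) (ρ : R → ℝ) (μ : A → ℝ)
    (hμ : ∀ a (G : Bool → ℝ), ∑ r, ρ r * G (val r a) = μ a * G true + (1 - μ a) * G false)
    (t : ℕ) (F : (Fin t → Θ × A × Bool) → ℝ) :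
    ∑ h, histLaw (rowStep π val ρ) t h * F (fun s => ((h s).1, (h s).2.1, val (h s).2.2 (h s).2.1))
      = ∑ h, histLaw (banditStep π μ) t h * F h := by
  refine sum_histLaw_map (fun y : Θ × A × R => (y.1, y.2.1, val y.2.2 y.2.1)) ?_ t F
  intro t h G
  rw [sum_rowStep_mul, sum_banditStep_mul]
  refine Finset.sum_congr rfl fun θ _ => ?_
  congr 1
  refine Finset.sum_congr rfl fun a _ => ?_
  rw [hμ a fun b => G (θ, a, b)]

/-- Averaging the excess loss over a fixed policy over independent random loss vectors. -/
theorem sum_prod_mul_excess (π : Strategy Θ) (val : R → A → Bool) (ρ : R → ℝ) (μ : A → ℝ)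
    (hρ : ∑ r, ρ r = 1)
    (hμ : ∀ a (G : Bool → ℝ), ∑ r, ρ r * G (val r a) = μ a * G true + (1 - μ a) * G false)
    (θ₀ : PMF A) (T : ℕ) :
    ∑ L : Fin T → R, (∏ s, ρ (L s)) * ∑ ω : Fin T → Θ × A,
        (playLaw π (lossSeq val L) T ω).toReal *
          ∑ t : Fin T, (policyLoss (lossSeq val L t) (ω t).1.1 - policyLoss (lossSeq val L t) θ₀) =
      ∑ h, histLaw (banditStep π μ) T h *
        ∑ t, (policyLoss μ (h t).1.1 - policyLoss μ θ₀) := by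
  have hmean : ∀ θ : PMF A, ∑ r, ρ r * policyLoss (fun a => lossOf (val r a)) θ =
      policyLoss μ θ := by
    intro θ
    simp only [policyLoss, Finset.mul_sum]
    rw [Finset.sum_comm]
    refine Finset.sum_congr rfl fun a _ => ?_
    have := hμ a lossOf
    simp only [lossOf, Bool.false_eq_true, if_true, if_false, mul_zero, add_zero, mul_one] at this
    rw [← this, Finset.mul_sum]
    refine Finset.sum_congr rfl fun r _ => ?_
    simp only [lossOf]
    ring
  calc _ = ∑ h : Fin T → Θ × A × R, histLaw (rowStep π val ρ) T h *
        ∑ t, (policyLoss (fun a => lossOf (val (h t).2.2 a)) (h t).1.1 -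
          policyLoss (fun a => lossOf (val (h t).2.2 a)) θ₀) := by
        simp only [Finset.mul_sum (s := (Finset.univ : Finset (Fin T → Θ × A)))]
        rw [Finset.sum_comm, ← Fintype.sum_prod_type'
          (f := fun (ω : Fin T → Θ × A) (L : Fin T → R) => (∏ s, ρ (L s)) *
            ((playLaw π (lossSeq val L) T ω).toReal * ∑ t : Fin T,
            (policyLoss (lossSeq val L t) (ω t).1.1 - policyLoss (lossSeq val L t) θ₀)))]
        refine Fintype.sum_equiv ((Equiv.arrowProdEquivProdArrow _ _ _).symm.trans
          (Equiv.arrowCongr (Equiv.refl _) (Equiv.prodAssoc Θ A R))) _ _ ?_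
        rintro ⟨ω, L⟩
        rw [histLaw_rowStep π val ρ (lossSeq val L) T]
        · simp [lossSeq_coe, mul_assoc]
        · intro s a
          simp [lossSeq_coe]
    _ = ∑ h : Fin T → Θ × A × R, histLaw (rowStep π val ρ) T h *
        ∑ t, (policyLoss μ (h t).1.1 - policyLoss μ θ₀) := by
        -- Given the past, the current loss vector is independent of the current policy and may be
        -- replaced by its mean.
        refine sum_histLaw_mul_sum_congr (κ := rowStep π val ρ) (sum_rowStep π val hρ)
          (g := fun y => policyLoss (fun a => lossOf (val y.2.2 a)) y.1.1 -
            policyLoss (fun a => lossOf (val y.2.2 a)) θ₀)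
          (g' := fun y => policyLoss μ y.1.1 - policyLoss μ θ₀) (fun t h => ?_) T
        rw [sum_rowStep_mul, sum_rowStep_mul]
        simp only [mul_sub, Finset.sum_sub_distrib, hmean, ← Finset.sum_mul, hρ, one_mul]
    _ = _ := sum_histLaw_rowStep_map π val ρ μ hμ T
        fun h => ∑ t, (policyLoss μ (h t).1.1 - policyLoss μ θ₀)

/-- Some sequence of loss vectors makes the regret at least its mean. -/
theorem exists_le_regret (π : Strategy Θ) (val : R → A → Bool) (ρ : R → ℝ) (μ : A → ℝ)
    (hρ0 : ∀ r, 0 < ρ r) (hρ : ∑ r, ρ r = 1)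
    (hμ : ∀ a (G : Bool → ℝ), ∑ r, ρ r * G (val r a) = μ a * G true + (1 - μ a) * G false)
    {θ₀ : PMF A} (hθ₀ : θ₀ ∈ Θ) (T : ℕ) :
    ∃ ℓ : ℕ → A → ℝ, (∀ t a, ℓ t a ∈ Set.Icc (0 : ℝ) 1) ∧
      ∑ h, histLaw (banditStep π μ) T h * ∑ t, (policyLoss μ (h t).1.1 - policyLoss μ θ₀) ≤
        regret π ℓ T := by
  set B := ∑ h, histLaw (banditStep π μ) T h *
    ∑ t, (policyLoss μ (h t).1.1 - policyLoss μ θ₀) with hB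
  have hw : ∑ L : Fin T → R, ∏ s, ρ (L s) = 1 := by
    rw [← Fintype.piFinset_univ, Finset.sum_prod_piFinset]
    simp [hρ]
  have hR : Nonempty R := by
    by_contra hR
    rw [not_nonempty_iff] at hR
    simp at hρ
  obtain ⟨L, -, hL⟩ := Finset.exists_le_of_sum_le (s := (Finset.univ : Finset (Fin T → R)))
    (f := fun L => (∏ s, ρ (L s)) * B)
    (g := fun L => (∏ s, ρ (L s)) * ∑ ω : Fin T → Θ × A,
        (playLaw π (lossSeq val L) T ω).toReal *
          ∑ t : Fin T, (policyLoss (lossSeq val L t) (ω t).1.1 - policyLoss (lossSeq val L t) θ₀))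
    Finset.univ_nonempty (by
      rw [sum_prod_mul_excess π val ρ μ hρ hμ θ₀ T, ← Finset.sum_mul, hw, one_mul])
  refine ⟨lossSeq val L, lossSeq_mem_Icc val L, ?_⟩
  -- Strict positivity of `ρ` allows the weight of `L` to be cancelled.
  have hL' := le_of_mul_le_mul_left hL (Finset.prod_pos fun s _ => hρ0 _)
  refine hL'.trans ?_
  simp only [Finset.sum_sub_distrib, mul_sub, ← Finset.sum_mul, pmf_sum_toReal, one_mul, regret]
  gcongr
  exact ciInf_le (Set.finite_range _).bddBelow (⟨θ₀, hθ₀⟩ : Θ)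

end play


/-! ### Stochastic environments with good arms -/

/-- The mean losses `1 / 2`, lowered by `ε` at the good arms. -/
noncomputable def goodMean {A : Type*} (ε : ℝ) (s : A → Bool) (a : A) : ℝ :=
  1 / 2 - if s a then ε else 0

theorem goodMean_mem_Icc {A : Type*} {ε : ℝ} (h0 : 0 < ε) (h1 : ε ≤ 1 / 4) (s : A → Bool) (a : A) :
    goodMean ε s a ∈ Set.Icc (0 : ℝ) 1 := by
  unfold goodMean
  split_ifs <;> constructor <;> linarith

/-- Loss vectors with the means `goodMean ε s`: all zero, all one, or one except at the good
arms. -/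
def goodRow {A : Type*} (s : A → Bool) : Fin 3 → A → Bool :=
  ![fun _ => false, fun _ => true, fun a => !s a]

/-- Only one-arm marginals matter to the player, so the losses of different arms may be fully
correlated and three loss vectors suffice. -/
theorem sum_goodRow {A : Type*} (ε : ℝ) (s : A → Bool) (a : A) (G : Bool → ℝ) :
    ∑ r, (![1 / 2, 1 / 2 - ε, ε] : Fin 3 → ℝ) r * G (goodRow s r a) =
      goodMean ε s a * G true + (1 - goodMean ε s a) * G false := by
  rw [Fin.sum_univ_three]
  cases h : s a <;> simp [goodRow, goodMean, h] <;> ring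

theorem exists_goodMean_le_regret {A : Type*} [Fintype A] {Θ : Finset (PMF A)} (π : Strategy Θ)
    {ε : ℝ} (h0 : 0 < ε) (h1 : ε ≤ 1 / 4) (s : A → Bool) {θ₀ : PMF A} (hθ₀ : θ₀ ∈ Θ) (T : ℕ) :
    ∃ ℓ : ℕ → A → ℝ, (∀ t a, ℓ t a ∈ Set.Icc (0 : ℝ) 1) ∧
      ∑ h, histLaw (banditStep π (goodMean ε s)) T h *
        ∑ t, (policyLoss (goodMean ε s) (h t).1.1 - policyLoss (goodMean ε s) θ₀) ≤
        regret π ℓ T := by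
  refine exists_le_regret π (goodRow s) ![1 / 2, 1 / 2 - ε, ε] (goodMean ε s) ?_ ?_
    (sum_goodRow ε s) hθ₀ T
  · intro r
    fin_cases r <;> simp [h0]
    linarith
  · rw [Fin.sum_univ_three]
    simp
    ring

/-- One additional good arm changes the mean of a `[0, 1]`-valued function of the history by at
most the root of the information gathered when this arm is played. -/
theorem sum_histLaw_update_le {A : Type*} [Fintype A] [DecidableEq A] {Θ : Finset (PMF A)}
    (π : Strategy Θ) {ε : ℝ} (h0 : 0 < ε) (h1 : ε ≤ 1 / 4) (s : A → Bool) {a₀ : A}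
    (ha₀ : s a₀ = false) (T : ℕ) (f : (Fin T → Θ × A × Bool) → ℝ)
    (hf : ∀ h, f h ∈ Set.Icc (0 : ℝ) 1) :
    ∑ h, histLaw (banditStep π (goodMean ε (Function.update s a₀ true))) T h * f h ≤
      ∑ h, histLaw (banditStep π (goodMean ε s)) T h * f h +
        √(1 / 2 * (-(1 / 2) * Real.log (1 - 4 * ε ^ 2) *
          ∑ h, histLaw (banditStep π (goodMean ε s)) T h *
            ∑ t, if (h t).2.1 = a₀ then 1 else 0)) := by
  -- Likelihood ratio of one observation: mean `1/2 - ε` against a fair coin at `a₀`, and `1` at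
  -- every other arm.
  set r : Θ × A × Bool → ℝ := fun y => if y.2.1 = a₀ then 2 * bern (1 / 2 - ε) y.2.2 else 1 with hr
  have hr0 : ∀ y, 0 < r y := by
    intro y
    simp only [hr, bern]
    split_ifs <;> linarith
  have hstep : banditStep π (goodMean ε (Function.update s a₀ true)) =
      fun t h y => banditStep π (goodMean ε s) t h y * r y := by
    funext t h y
    simp only [banditStep, mul_assoc, hr]
    congr 2
    by_cases hy : y.2.1 = a₀
    · simp only [hy, goodMean, Function.update_self, ha₀, bern]
      cases y.2.2 <;> simp
      ring
    · simp [goodMean, hy]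
  have hsum := sum_histLaw (sum_banditStep π (goodMean ε (Function.update s a₀ true))) T
  simp only [hstep, histLaw_mul_ratio] at hsum ⊢
  refine (sum_ratio_le_add_sqrt (histLaw (banditStep π (goodMean ε s)) T)
    (fun h => ∏ t, r (h t)) f
    (histLaw_nonneg (banditStep_nonneg π (goodMean_mem_Icc h0 h1 s)) T)
    (sum_histLaw (sum_banditStep π _) T) (fun h => Finset.prod_pos fun t _ => hr0 _) hsum
    hf).trans_eq ?_
  congr 3
  have e1 : ∀ h : Fin T → Θ × A × Bool,
      -Real.log (∏ t, r (h t)) = ∑ t, -Real.log (r (h t)) := by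
    intro h
    rw [Real.log_prod fun t _ => (hr0 _).ne', Finset.sum_neg_distrib]
  simp only [e1]
  -- Chain rule for the divergence: each play of `a₀` contributes the divergence of a fair coin from
  -- a coin of mean `1/2 - ε`, namely `-(1/2) log (1 - 4ε²)`.
  rw [sum_histLaw_mul_sum_congr (sum_banditStep π _) (g := fun y => -Real.log (r y))
    (g' := fun y => -(1 / 2) * Real.log (1 - 4 * ε ^ 2) * if y.2.1 = a₀ then 1 else 0) ?_ T]
  · simp only [← Finset.mul_sum, mul_left_comm _ (-(1 / 2) * Real.log (1 - 4 * ε ^ 2))]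
  · intro t h
    rw [sum_banditStep_mul, sum_banditStep_mul]
    refine Finset.sum_congr rfl fun θ _ => ?_
    congr 1
    refine Finset.sum_congr rfl fun a _ => ?_
    congr 1
    by_cases ha : a = a₀
    · subst ha
      have e2 : Real.log (1 - 4 * ε ^ 2) = Real.log (1 - 2 * ε) + Real.log (1 + 2 * ε) := by
        rw [← Real.log_mul (by linarith) (by linarith)]
        congr 1
        ring
      simp only [hr, goodMean, ha₀, bern, if_true, e2, Bool.false_eq_true, if_false]
      rw [show 2 * (1 / 2 - ε) = 1 - 2 * ε by ring, show 2 * (1 - (1 / 2 - ε)) = 1 + 2 * ε by ring]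
      ring
    · simp [hr, ha]

/-! ### Averaging over the good arms -/

/-- Exchanging `σ i` with the extra coordinate is an involution: resampling one coordinate keeps the
uniform law on `σ`. -/
theorem sum_sum_update {ι κ : Type*} [Fintype ι] [DecidableEq ι] [Fintype κ]
    (i : ι) (g : (ι → κ) → ℝ) :
    ∑ σ, ∑ j, g (Function.update σ i j) = Fintype.card κ * ∑ σ, g σ := by
  have e : Function.Involutive
      (fun x : (ι → κ) × κ => ((Function.update x.1 i x.2, x.1 i) : (ι → κ) × κ)) := by
    rintro ⟨σ, j⟩
    simp
  rw [← Fintype.sum_prod_type' (f := fun σ j => g (Function.update σ i j)),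
    Fintype.sum_bijective _ e.bijective _ (fun x : (ι → κ) × κ => g x.1) fun _ => rfl,
    Fintype.sum_prod_type]
  simp [Finset.mul_sum]

theorem sum_sqrt_le {ι : Type*} [Fintype ι] (x : ι → ℝ) (hx : ∀ i, 0 ≤ x i) :
    ∑ i, √(x i) ≤ √(Fintype.card ι * ∑ i, x i) := by
  refine Real.le_sqrt_of_sq_le ?_
  have := sq_sum_le_card_mul_sum_sq (s := Finset.univ) (f := fun i => √(x i))
  simpa [Real.sq_sqrt (hx _)] using this

section multiTask

variable {M q : ℕ} {Θ : Finset (PMF (Fin M × Fin q))}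

/-- The good arms are the ones selected by `σ`. -/
def goodArms (σ : Fin M → Fin q) (a : Fin M × Fin q) : Bool := decide (σ a.1 = a.2)

/-- The good arms are the ones selected by `σ` outside of the section `i`. -/
def goodArmsOff (i : Fin M) (σ : Fin M → Fin q) (a : Fin M × Fin q) : Bool :=
  decide (a.1 ≠ i ∧ σ a.1 = a.2)

/-- `goodArmsOff i σ` ignores `σ i`, so the `q` environments obtained by moving the good arm of
section `i` share one reference and each differ from it at one arm. -/
theorem goodArms_update (i : Fin M) (σ : Fin M → Fin q) (j : Fin q) :
    goodArms (Function.update σ i j) = Function.update (goodArmsOff i σ) (i, j) true := by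
  funext ⟨i', j'⟩
  by_cases hi : i' = i
  · subst hi
    by_cases hj : j = j'
    · subst hj
      simp [goodArms]
    · rw [Function.update_of_ne (by simp [Ne.symm hj])]
      simp [goodArms, goodArmsOff, hj]
  · rw [Function.update_of_ne (by simp [hi])]
    simp [goodArms, goodArmsOff, hi]

theorem policyLoss_goodMean (ε : ℝ) (σ : Fin M → Fin q) (θ : PMF (Fin M × Fin q)) :
    policyLoss (goodMean ε (goodArms σ)) θ = 1 / 2 - ε * ∑ i, (θ (i, σ i)).toReal := by
  have h : ∀ a : Fin M × Fin q, (θ a).toReal * goodMean ε (goodArms σ) a =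
      1 / 2 * (θ a).toReal - ε * if σ a.1 = a.2 then (θ a).toReal else 0 := by
    intro a
    by_cases ha : σ a.1 = a.2 <;> simp [goodMean, goodArms, ha] <;> ring
  simp only [policyLoss, h, Finset.sum_sub_distrib, ← Finset.mul_sum, pmf_sum_toReal,
    Fintype.sum_prod_type]
  simp

/-- In one section, averaging over the position of its good arm. -/
theorem sum_update_weight_le (hM : 1 ≤ M) (hΘ : ∀ θ ∈ Θ, ∀ i, ∑ j, (θ (i, j)).toReal = 1 / M)
    (π : Strategy Θ) {ε : ℝ} (h0 : 0 < ε) (h1 : ε ≤ 1 / 4) {T : ℕ} (hT : 0 < T)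
    (σ : Fin M → Fin q) (i : Fin M) :
    ∑ j, ∑ h, histLaw (banditStep π (goodMean ε (goodArms (Function.update σ i j)))) T h *
        ∑ t, ((h t).1.1 (i, j)).toReal ≤
      T / M * (1 + √(q * (1 / 2 * (-(1 / 2) * Real.log (1 - 4 * ε ^ 2) * (T / M))))) := by
  have hM0 : (0 : ℝ) < M := by exact_mod_cast hM
  have hT0 : (0 : ℝ) < T := by exact_mod_cast hT
  set c := -(1 / 2) * Real.log (1 - 4 * ε ^ 2) with hc
  have hc0 : 0 ≤ c := by
    have : Real.log (1 - 4 * ε ^ 2) ≤ 0 := Real.log_nonpos (by nlinarith) (by nlinarith)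
    rw [hc]
    linarith
  set P := histLaw (banditStep π (goodMean ε (goodArmsOff i σ))) T with hP
  have hP0 : ∀ h, 0 ≤ P h :=
    histLaw_nonneg (banditStep_nonneg π (goodMean_mem_Icc h0 h1 _)) T
  have hP1 : ∑ h, P h = 1 := sum_histLaw (sum_banditStep π _) T
  set n : Fin q → ℝ := fun j => ∑ h, P h * ∑ t, if (h t).2.1 = (i, j) then 1 else 0 with hn
  have hn0 : ∀ j, 0 ≤ n j := fun j => Finset.sum_nonneg fun h _ =>
    mul_nonneg (hP0 h) (Finset.sum_nonneg fun t _ => by split_ifs <;> simp)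
  -- Each round hits section `i` with probability exactly `1/M`, so no strategy can explore it
  -- faster.
  have hn1 : ∑ j, n j = T / M := by
    simp only [hn]
    rw [Finset.sum_comm]
    simp only [← Finset.mul_sum]
    have e1 : ∀ h : Fin T → Θ × (Fin M × Fin q) × Bool,
        ∑ j, ∑ t, (if (h t).2.1 = (i, j) then (1 : ℝ) else 0) =
          ∑ t, if (h t).2.1.1 = i then 1 else 0 := by
      intro h
      rw [Finset.sum_comm]
      refine Finset.sum_congr rfl fun t _ => ?_
      by_cases hi : (h t).2.1.1 = i <;> simp [Prod.ext_iff, hi]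
    simp only [e1]
    rw [sum_histLaw_mul_sum_congr (sum_banditStep π _)
      (g := fun y => if y.2.1.1 = i then 1 else 0) (g' := fun _ => (1 : ℝ) / M) ?_ T]
    · simp only [Finset.sum_const, Finset.card_univ, Fintype.card_fin, ← Finset.sum_mul, nsmul_eq_mul]
      change (∑ h, P h) * _ = _
      rw [hP1]
      ring
    · intro t h
      rw [sum_banditStep_mul, sum_banditStep_mul]
      refine Finset.sum_congr rfl fun θ _ => ?_
      congr 1
      simp only [← add_mul, add_sub_cancel, one_mul, ← Finset.sum_mul, pmf_sum_toReal]
      rw [← hΘ θ.1 θ.2 i, Fintype.sum_prod_type, Finset.sum_eq_single i]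
      · simp
      · intro i' _ hi
        simp [hi]
      · simp
  -- Normalized so that the `f j` sum to `1`; this makes each `[0,1]`-valued, as Pinsker's
  -- inequality requires.
  set f : Fin q → (Fin T → Θ × (Fin M × Fin q) × Bool) → ℝ :=
    fun j h => M / T * ∑ t, ((h t).1.1 (i, j)).toReal with hf
  have hf1 : ∀ h, ∑ j, f j h = 1 := by
    intro h
    simp only [hf, ← Finset.mul_sum]
    rw [Finset.sum_comm]
    simp only [hΘ _ (h _).1.2 i, Finset.sum_const, Finset.card_univ, Fintype.card_fin, nsmul_eq_mul]
    field_simp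
  have hf0 : ∀ j h, 0 ≤ f j h := fun j h => by positivity
  have hfI : ∀ j h, f j h ∈ Set.Icc (0 : ℝ) 1 := fun j h =>
    ⟨hf0 j h, by
      rw [← hf1 h]
      exact Finset.single_le_sum (f := fun j => f j h) (fun j _ => hf0 j h) (Finset.mem_univ j)⟩
  have hfw : ∀ j h, ∑ t, ((h t).1.1 (i, j)).toReal = T / M * f j h := by
    intro j h
    simp only [hf]
    field_simp
  simp only [hfw, mul_left_comm _ ((T : ℝ) / M), ← Finset.mul_sum]
  refine mul_le_mul_of_nonneg_left ?_ (by positivity)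
  calc _ ≤ ∑ j, (∑ h, P h * f j h + √(1 / 2 * (c * n j))) := by
        refine Finset.sum_le_sum fun j _ => ?_
        rw [goodArms_update]
        exact sum_histLaw_update_le π h0 h1 (goodArmsOff i σ) (by simp [goodArmsOff]) T (f j)
          (hfI j)
    _ = 1 + ∑ j, √(1 / 2 * (c * n j)) := by
        rw [Finset.sum_add_distrib, Finset.sum_comm]
        simp only [← Finset.mul_sum, hf1, mul_one, hP1]
    -- Cauchy–Schwarz over the `q` positions leaves only the total number of plays `T / M`.
    _ ≤ _ := by
        have := sum_sqrt_le (fun j => 1 / 2 * (c * n j)) fun j => by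
          have := hn0 j
          positivity
        simp only [← Finset.mul_sum, hn1, Fintype.card_fin] at this
        linarith

/-- Some sequence of loss vectors makes the regret at least the one averaged over the good
arms. -/
theorem exists_gap_le_regret (hM : 1 ≤ M) (hq : 1 ≤ q)
    (hΘ : ∀ θ ∈ Θ, ∀ i, ∑ j, (θ (i, j)).toReal = 1 / M)
    (hσ : ∀ σ : Fin M → Fin q, ∃ θ ∈ Θ, ∀ i, (θ (i, σ i)).toReal = 1 / M)
    (π : Strategy Θ) {ε : ℝ} (h0 : 0 < ε) (h1 : ε ≤ 1 / 4) {T : ℕ} (hT : 0 < T) :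
    ∃ ℓ : ℕ → Fin M × Fin q → ℝ, (∀ t a, ℓ t a ∈ Set.Icc (0 : ℝ) 1) ∧
      ε * T * (1 - 1 / q * (1 + √(q * (1 / 2 * (-(1 / 2) * Real.log (1 - 4 * ε ^ 2) * (T / M))))))
        ≤ regret π ℓ T := by
  have hM0 : (0 : ℝ) < M := by exact_mod_cast hM
  have hq0 : (0 : ℝ) < q := by exact_mod_cast hq
  set B := 1 + √(q * (1 / 2 * (-(1 / 2) * Real.log (1 - 4 * ε ^ 2) * (T / M)))) with hB
  choose θ₀ hθ₀ hw using hσ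
  set G : Fin M → (Fin M → Fin q) → ℝ := fun i σ =>
    ∑ h, histLaw (banditStep π (goodMean ε (goodArms σ))) T h *
      ∑ t, ((h t).1.1 (i, σ i)).toReal with hG
  -- The comparator has all its mass on good arms, so the excess loss is `ε` times the mass missing
  -- from them.
  have hX : ∀ σ, ∑ h, histLaw (banditStep π (goodMean ε (goodArms σ))) T h *
      ∑ t, (policyLoss (goodMean ε (goodArms σ)) (h t).1.1 -
        policyLoss (goodMean ε (goodArms σ)) (θ₀ σ)) = ε * T - ε * ∑ i, G i σ := by
    intro σ
    have e1 : ∀ h : Fin T → Θ × (Fin M × Fin q) × Bool,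
        ∑ t, (policyLoss (goodMean ε (goodArms σ)) (h t).1.1 -
          policyLoss (goodMean ε (goodArms σ)) (θ₀ σ)) =
        ε * T - ε * ∑ i, ∑ t, ((h t).1.1 (i, σ i)).toReal := by
      intro h
      rw [Finset.sum_comm]
      simp only [policyLoss_goodMean, hw]
      simp only [Finset.sum_sub_distrib, Finset.sum_const, Finset.card_univ, Fintype.card_fin,
        nsmul_eq_mul, ← Finset.mul_sum]
      field_simp
      ring
    simp only [e1, mul_sub, Finset.sum_sub_distrib, ← Finset.sum_mul,
      sum_histLaw (sum_banditStep π _) T, one_mul, hG]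
    congr 1
    rw [Finset.sum_comm, Finset.mul_sum]
    refine Finset.sum_congr rfl fun h _ => ?_
    rw [← Finset.mul_sum]
    ring
  have hGi : ∀ i, ∑ σ, G i σ ≤ (q : ℝ) ^ M * (T / M * (1 / q * B)) := by
    intro i
    have e := sum_sum_update (κ := Fin q) i (G i)
    have hle : ∑ σ, ∑ j, G i (Function.update σ i j) ≤
        ∑ _σ : Fin M → Fin q, (T / M * B : ℝ) := by
      refine Finset.sum_le_sum fun σ _ => ?_
      simp only [hG, Function.update_self]
      exact sum_update_weight_le hM hΘ π h0 h1 hT σ i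
    rw [e] at hle
    simp only [Finset.sum_const, Finset.card_univ, Fintype.card_fin, nsmul_eq_mul,
      Fintype.card_pi, Finset.prod_const, Nat.cast_pow] at hle
    rw [← mul_le_mul_iff_right₀ hq0]
    refine hle.trans_eq ?_
    field_simp
  have hsum : ∑ _σ : Fin M → Fin q, ε * T * (1 - 1 / q * B) ≤
      ∑ σ, (ε * T - ε * ∑ i, G i σ) := by
    have e2 : ∑ i, ∑ σ, G i σ ≤ ∑ _i : Fin M, (q : ℝ) ^ M * (T / M * (1 / q * B)) :=
      Finset.sum_le_sum fun i _ => hGi i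
    have e5 : ∑ σ, ε * ∑ i, G i σ = ε * ∑ i, ∑ σ, G i σ := by
      rw [← Finset.mul_sum, Finset.sum_comm]
    rw [Finset.sum_sub_distrib, e5]
    simp only [Finset.sum_const, Finset.card_univ, Fintype.card_fin, nsmul_eq_mul,
      Fintype.card_pi, Finset.prod_const, Nat.cast_pow] at e2 ⊢
    have e3 := mul_le_mul_of_nonneg_left e2 h0.le
    have e4 : ε * (M * ((q : ℝ) ^ M * (T / M * (1 / q * B)))) =
        (q : ℝ) ^ M * (ε * T * (1 / q * B)) := by
      field_simp
    rw [e4] at e3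
    linarith
  have : Nonempty (Fin M → Fin q) := ⟨fun _ => ⟨0, hq⟩⟩
  -- Some `σ` does at least as well as the uniform average.
  obtain ⟨σ, -, hσ⟩ := Finset.exists_le_of_sum_le Finset.univ_nonempty hsum
  obtain ⟨ℓ, hℓ, hreg⟩ := exists_goodMean_le_regret π h0 h1 (goodArms σ) (hθ₀ σ) T
  rw [hX σ] at hreg
  exact ⟨ℓ, hℓ, hσ.trans hreg⟩

end multiTask

/-! ### Tuning the gap -/

/-- By concavity, `log` lies above its chord between `3/4` and `1`. -/
theorem neg_log_one_sub_le {x : ℝ} (h0 : 0 ≤ x) (h1 : x ≤ 1 / 4) :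
    -Real.log (1 - x) ≤ 4 * Real.log (4 / 3) * x := by
  have h := strictConcaveOn_log_Ioi.concaveOn.2 (Set.mem_Ioi.2 one_pos)
    (Set.mem_Ioi.2 (by norm_num : (0 : ℝ) < 3 / 4)) (by linarith : 0 ≤ 1 - 4 * x)
    (by linarith : 0 ≤ 4 * x) (by ring)
  simp only [smul_eq_mul, Real.log_one, mul_zero, zero_add] at h
  rw [show (1 - 4 * x) * 1 + 4 * x * (3 / 4) = 1 - x by ring,
    show (3 / 4 : ℝ) = (4 / 3)⁻¹ by norm_num, Real.log_inv] at h
  linarith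

/-- The value `9/16` makes the final constant exact: `32 * (9/16) = 18`. -/
theorem log_four_thirds_le : Real.log (4 / 3) ≤ (9 / 16) ^ 2 := by
  rw [Real.log_le_iff_le_exp (by norm_num)]
  refine le_trans ?_ (Real.quadratic_le_exp_of_nonneg (by norm_num))
  norm_num

/-- The tuned gap. -/
theorem exists_gap {K T q M : ℝ} (hK : K = q * M) (hq : 2 ≤ q) (hM : 0 < M) (hT0 : 0 < T)
    (hT : K / (4 * Real.log (4 / 3)) ≤ T) :
    ∃ ε : ℝ, 0 < ε ∧ ε ≤ 1 / 4 ∧ 1 / 18 * √(K * T) ≤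
      ε * T * (1 - 1 / q *
        (1 + √(q * (1 / 2 * (-(1 / 2) * Real.log (1 - 4 * ε ^ 2) * (T / M)))))) := by
  have hK0 : 0 < K := by rw [hK]; positivity
  set l := Real.log (4 / 3) with hl
  have hl0 : 0 < l := Real.log_pos (by norm_num)
  set w := √(l * T / K) with hw
  have hw2 : w ^ 2 = l * T / K := Real.sq_sqrt (by positivity)
  -- This is the assumption on `T`; it gives `4ε² ≤ 1/4`, the range of `neg_log_one_sub_le`.
  have hw0 : 1 / 2 ≤ w := by
    refine Real.le_sqrt_of_sq_le ?_
    rw [div_le_iff₀ (by positivity)] at hT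
    rw [le_div_iff₀ hK0]
    linarith
  have hε : 1 / (8 * w) ≤ 1 / 4 := one_div_le_one_div_of_le (by norm_num) (by linarith)
  refine ⟨1 / (8 * w), by positivity, hε, ?_⟩
  set ε := 1 / (8 * w) with hεd
  have hε0 : 0 < ε := by positivity
  have hsq : √(q * (1 / 2 * (-(1 / 2) * Real.log (1 - 4 * ε ^ 2) * (T / M)))) ≤ q * (2 * ε * w) := by
    refine Real.sqrt_le_iff.2 ⟨by positivity, ?_⟩
    have h1 := neg_log_one_sub_le (x := 4 * ε ^ 2) (by positivity) (by nlinarith)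
    have h2 : (q * (2 * ε * w)) ^ 2 =
        q * (1 / 2 * (1 / 2 * (4 * l * (4 * ε ^ 2)) * (T / M))) := by
      rw [mul_pow, mul_pow, hw2, hK]
      field_simp
      ring
    rw [h2]
    gcongr q * (1 / 2 * (?_ * (T / M)))
    linarith
  -- With `ε w = 1/8` the root is at most `q/4`, and `1 - 1/q - 1/4 ≥ 1/4` since `q ≥ 2`.
  have hbr : 1 / 4 ≤ 1 - 1 / q *
      (1 + √(q * (1 / 2 * (-(1 / 2) * Real.log (1 - 4 * ε ^ 2) * (T / M))))) := by
    have h3 : 1 / q * (1 + √(q * (1 / 2 * (-(1 / 2) * Real.log (1 - 4 * ε ^ 2) * (T / M))))) ≤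
        1 / q * (1 + q * (2 * ε * w)) := by gcongr
    have h4 : 1 / q * (1 + q * (2 * ε * w)) = 1 / q + 1 / 4 := by
      rw [hεd]
      field_simp
      ring
    have h5 : 1 / q ≤ 1 / 2 := one_div_le_one_div_of_le (by norm_num) hq
    linarith
  refine le_trans ?_ (mul_le_mul_of_nonneg_left hbr (by positivity))
  have h6 : w * √(K * T) ≤ 9 / 16 * T := by
    rw [hw, ← Real.sqrt_mul (by positivity)]
    refine Real.sqrt_le_iff.2 ⟨by positivity, ?_⟩
    rw [show l * T / K * (K * T) = l * T ^ 2 by field_simp, mul_pow]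
    gcongr
    exact log_four_thirds_le
  rw [hεd, show 1 / (8 * w) * T * (1 / 4) = T / (32 * w) by field_simp; norm_num,
    le_div_iff₀ (by positivity)]
  linarith


/-! ### Kullback-Leibler divergence of distributions on a finite type -/

section kl

variable {A : Type*} [MeasurableSpace A] [MeasurableSingletonClass A]

theorem klDiv_toMeasure_eq_top {p τ : PMF A} {a : A} (hτ : τ a = 0) (hp : p a ≠ 0) :
    InformationTheory.klDiv p.toMeasure τ.toMeasure = ∞ := by
  refine InformationTheory.klDiv_of_not_ac fun hac => hp ?_
  rw [← p.toMeasure_apply_singleton a (measurableSet_singleton a)]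
  exact hac (by rw [τ.toMeasure_apply_singleton a (measurableSet_singleton a), hτ])

open MeasureTheory in
theorem klDiv_toMeasure [Fintype A] {p τ : PMF A} (h : ∀ a, τ a = 0 → p a = 0) :
    InformationTheory.klDiv p.toMeasure τ.toMeasure =
      ENNReal.ofReal (∑ a, (p a).toReal * Real.log ((p a).toReal / (τ a).toReal)) := by
  have hsing : ∀ (p : PMF A) a, p.toMeasure {a} = p a := fun p a =>
    p.toMeasure_apply_singleton a (measurableSet_singleton a)
  have hac : p.toMeasure ≪ τ.toMeasure := by
    refine Measure.AbsolutelyContinuous.mk fun s _ hs => ?_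
    rw [PMF.toMeasure_apply_fintype] at hs ⊢
    rw [Finset.sum_eq_zero_iff] at hs ⊢
    intro a _
    by_cases ha : a ∈ s
    · simpa [ha] using h a (by simpa [ha] using hs a (Finset.mem_univ a))
    · simp [ha]
  rw [InformationTheory.klDiv_of_ac_of_integrable hac .of_finite]
  simp only [probReal_univ, add_sub_cancel_right]
  rw [PMF.integral_eq_sum]
  congr 1
  refine Finset.sum_congr rfl fun a _ => ?_
  by_cases hτ : τ a = 0
  · simp [h a hτ]
  -- The density at an atom is read off by integrating it over the singleton.
  have hd : p a = p.toMeasure.rnDeriv τ.toMeasure a * τ a := by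
    rw [← hsing p, ← hsing τ]
    conv_lhs => rw [← Measure.withDensity_rnDeriv_eq _ _ hac]
    rw [withDensity_apply _ (measurableSet_singleton a), lintegral_singleton]
  rw [smul_eq_mul, llr]
  congr 2
  rw [hd, ENNReal.toReal_mul, mul_div_cancel_right₀]
  exact (ENNReal.toReal_pos hτ (τ.apply_ne_top a)).ne'

end kl

/-! ### The multi-task policies -/

section multiTask

variable {M q : ℕ}

theorem mem_uniformPolicies {A : Type*} [Fintype A] {M : ℕ} {θ : PMF A} :
    θ ∈ uniformPolicies A M ↔
      ∃ (S : Finset A) (hS : S.Nonempty), S.card = M ∧ PMF.uniformOfFinset S hS = θ := by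
  simp only [uniformPolicies, Finset.mem_image, Finset.mem_univ, true_and, Subtype.exists]
  exact ⟨fun ⟨S, hS, e⟩ => ⟨S, hS.1, hS.2, e⟩, fun ⟨S, hS, hc, e⟩ => ⟨S, ⟨hS, hc⟩, e⟩⟩

/-- The arms selected by `σ`. -/
def graphArms (σ : Fin M → Fin q) : Finset (Fin M × Fin q) :=
  Finset.univ.map ⟨fun i => (i, σ i), fun _ _ h => (Prod.ext_iff.1 h).1⟩

theorem mem_graphArms {σ : Fin M → Fin q} {a : Fin M × Fin q} :
    a ∈ graphArms σ ↔ σ a.1 = a.2 := by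
  simp only [graphArms, Finset.mem_map, Finset.mem_univ, true_and]
  constructor
  · rintro ⟨i, rfl⟩
    rfl
  · intro h
    exact ⟨a.1, Prod.ext rfl h⟩

theorem card_graphArms (σ : Fin M → Fin q) : (graphArms σ).card = M := by
  simp [graphArms]

/-- The multi-task policy that is uniform on the arms selected by `σ`. -/
noncomputable def graphPolicy (hM : 1 ≤ M) (σ : Fin M → Fin q) : PMF (Fin M × Fin q) :=
  PMF.uniformOfFinset (graphArms σ) (Finset.card_pos.1 (by rw [card_graphArms]; exact hM))

theorem graphPolicy_apply (hM : 1 ≤ M) (σ : Fin M → Fin q) (a : Fin M × Fin q) :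
    graphPolicy hM σ a = if σ a.1 = a.2 then (M : ℝ≥0∞)⁻¹ else 0 := by
  classical
  rw [graphPolicy, PMF.uniformOfFinset_apply]
  simp only [mem_graphArms, card_graphArms]

theorem graphPolicy_toReal (hM : 1 ≤ M) (σ : Fin M → Fin q) (a : Fin M × Fin q) :
    (graphPolicy hM σ a).toReal = if σ a.1 = a.2 then 1 / (M : ℝ) else 0 := by
  rw [graphPolicy_apply]
  split_ifs <;> simp

theorem graphPolicy_injective (hM : 1 ≤ M) :
    Function.Injective (graphPolicy hM : (Fin M → Fin q) → PMF (Fin M × Fin q)) := by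
  intro σ σ' h
  funext i
  have := DFunLike.congr_fun h (i, σ i)
  rw [graphPolicy_apply, graphPolicy_apply, if_pos rfl] at this
  by_contra hne
  rw [if_neg (fun h => hne h.symm)] at this
  simp at this

/-- Atoms have weight `1/M`, so section mass `1/M` forces exactly one support arm per section: the
support is a graph. -/
theorem mem_multiTaskPolicies (hM : 1 ≤ M) {θ : PMF (Fin M × Fin q)} :
    θ ∈ multiTaskPolicies M q ↔ ∃ σ, graphPolicy hM σ = θ := by
  classical
  simp only [multiTaskPolicies, Finset.mem_filter, mem_uniformPolicies]
  constructor
  · rintro ⟨⟨S, hS, hc, rfl⟩, hsec⟩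
    have hcard : ∀ i, ∃ j, (Finset.univ.filter fun j => (i, j) ∈ S) = {j} := by
      intro i
      rw [← Finset.card_eq_one]
      have h := hsec i
      simp only [PMF.uniformOfFinset_apply, hc] at h
      rw [← Finset.sum_filter, Finset.sum_const, nsmul_eq_mul] at h
      have hM0 : (M : ℝ≥0∞) ≠ 0 := by
        exact_mod_cast (Nat.one_le_iff_ne_zero.1 hM)
      have h2 := congrArg (· * (M : ℝ≥0∞)) h
      simp only [mul_assoc, ENNReal.inv_mul_cancel hM0 (ENNReal.natCast_ne_top M), mul_one] at h2
      exact_mod_cast h2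
    choose σ hσ using hcard
    refine ⟨σ, PMF.ext fun a => ?_⟩
    rw [graphPolicy_apply, PMF.uniformOfFinset_apply, hc]
    have : a ∈ S ↔ σ a.1 = a.2 := by
      have := Finset.ext_iff.1 (hσ a.1) a.2
      simp only [Finset.mem_filter, Finset.mem_univ, true_and, Finset.mem_singleton] at this
      rw [eq_comm, ← this]
    simp only [this]
  · rintro ⟨σ, rfl⟩
    refine ⟨⟨graphArms σ, _, card_graphArms σ, rfl⟩, fun i => ?_⟩
    simp [graphPolicy_apply]

theorem multiTaskPolicies_eq_map (hM : 1 ≤ M) :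
    multiTaskPolicies M q = Finset.univ.map ⟨graphPolicy hM, graphPolicy_injective hM⟩ := by
  ext θ
  simp [mem_multiTaskPolicies hM]

theorem card_multiTaskPolicies (hM : 1 ≤ M) : (multiTaskPolicies M q).card = q ^ M := by
  rw [multiTaskPolicies_eq_map hM]
  simp

theorem sum_section_toReal (hM : 1 ≤ M) {θ : PMF (Fin M × Fin q)}
    (hθ : θ ∈ multiTaskPolicies M q) (i : Fin M) : ∑ j, (θ (i, j)).toReal = 1 / M := by
  obtain ⟨σ, rfl⟩ := (mem_multiTaskPolicies hM).1 hθ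
  simp [graphPolicy_toReal]

theorem SStar_multiTaskPolicies (hM : 1 ≤ M) (hq : 2 ≤ q) : SStar (multiTaskPolicies M q) = q := by
  have hM0 : (0 : ℝ) < M := by exact_mod_cast hM
  have hmem : ∀ σ, graphPolicy hM σ ∈ multiTaskPolicies M q := fun σ =>
    (mem_multiTaskPolicies hM).2 ⟨σ, rfl⟩
  have hne : Nonempty (multiTaskPolicies M q) := ⟨⟨_, hmem fun _ => ⟨0, by omega⟩⟩⟩
  have : Nontrivial (Fin q) := Fin.nontrivial_iff_two_le.2 hq
  have hsup : ∀ a : Fin M × Fin q, ⨆ θ : multiTaskPolicies M q, (θ.1 a).toReal = 1 / M := by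
    intro a
    refine le_antisymm (ciSup_le fun θ => ?_) ?_
    · obtain ⟨σ, hσ⟩ := (mem_multiTaskPolicies hM).1 θ.2
      rw [← hσ, graphPolicy_toReal]
      split_ifs
      · exact le_rfl
      · positivity
    · refine le_trans ?_ (le_ciSup (Set.finite_range _).bddAbove ⟨_, hmem fun _ => a.2⟩)
      simp [graphPolicy_toReal]
  have hinf : ∀ a : Fin M × Fin q, ⨅ θ : multiTaskPolicies M q, (θ.1 a).toReal = 0 := by
    intro a
    -- As `q ≥ 2`, some policy avoids the arm `a`.
    obtain ⟨j, hj⟩ := exists_ne a.2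
    refine le_antisymm ?_ (le_ciInf fun θ => ENNReal.toReal_nonneg)
    refine (ciInf_le (Set.finite_range _).bddBelow ⟨_, hmem fun _ => j⟩).trans ?_
    simp [graphPolicy_toReal, hj]
  simp only [SStar, hsup, hinf, sub_zero, Finset.sum_const, Finset.card_univ, Fintype.card_prod,
    Fintype.card_fin, nsmul_eq_mul]
  push_cast
  field_simp

/-- `g` also receives the weight, so that the summands `p log (p / τ)` have this shape. -/
theorem sum_graphPolicy_mul (hM : 1 ≤ M) (σ : Fin M → Fin q) (g : Fin M × Fin q → ℝ → ℝ) :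
    ∑ a, (graphPolicy hM σ a).toReal * g a (graphPolicy hM σ a).toReal =
      1 / M * ∑ i, g (i, σ i) (1 / M) := by
  rw [Fintype.sum_prod_type, Finset.mul_sum]
  refine Finset.sum_congr rfl fun i _ => ?_
  rw [Finset.sum_eq_single (σ i)]
  · simp [graphPolicy_toReal]
  · intro j _ hj
    simp [graphPolicy_toReal, hj.symm]
  · simp

/-- The uniform distribution on the arms has the divergence `log q` from every policy. -/
theorem maxKL_uniform_le (hM : 1 ≤ M) (hq : 1 ≤ q) [Nonempty (Fin M × Fin q)] :
    maxKL (multiTaskPolicies M q) (PMF.uniformOfFintype (Fin M × Fin q)) ≤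
      ENNReal.ofReal (Real.log q) := by
  have hM0 : (0 : ℝ) < M := by exact_mod_cast hM
  have hq0 : (0 : ℝ) < q := by exact_mod_cast hq
  refine iSup₂_le fun θ hθ => ?_
  obtain ⟨σ, rfl⟩ := (mem_multiTaskPolicies hM).1 hθ
  rw [klDiv_toMeasure]
  · rw [sum_graphPolicy_mul hM σ fun a x =>
      Real.log (x / (PMF.uniformOfFintype (Fin M × Fin q) a).toReal)]
    refine le_of_eq (congrArg _ ?_)
    have : 1 / (M : ℝ) / ((M : ℝ) * q)⁻¹ = q := by field_simp
    simp only [PMF.uniformOfFintype_apply, Fintype.card_prod, Fintype.card_fin,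
      ENNReal.toReal_inv, ENNReal.toReal_natCast, Nat.cast_mul, ENNReal.toReal_mul, this,
      Finset.sum_const, Finset.card_univ, nsmul_eq_mul]
    field_simp
  · intro a ha
    exact absurd ha ((PMF.uniformOfFintype (Fin M × Fin q)).mem_support_iff a |>.1 (by simp))

/-- Every distribution is at the divergence at least `log q` from the policy that selects the
least likely arm of each section. -/
theorem log_le_maxKL (hM : 1 ≤ M) (hq : 1 ≤ q) (τ : PMF (Fin M × Fin q)) :
    ENNReal.ofReal (Real.log q) ≤ maxKL (multiTaskPolicies M q) τ := by
  have hM0 : (0 : ℝ) < M := by exact_mod_cast hM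
  have hq0 : (0 : ℝ) < q := by exact_mod_cast hq
  have hne : Nonempty (Fin q) := ⟨⟨0, hq⟩⟩
  have hmin : ∀ i : Fin M, ∃ j, ∀ j', (τ (i, j)).toReal ≤ (τ (i, j')).toReal := fun i =>
    Finite.exists_min fun j => (τ (i, j)).toReal
  choose σ hσ using hmin
  refine le_trans ?_ (le_iSup₂ (f := fun θ _ => InformationTheory.klDiv θ.toMeasure τ.toMeasure)
    (graphPolicy hM σ) ((mem_multiTaskPolicies hM).2 ⟨σ, rfl⟩))
  by_cases hac : ∀ a, τ a = 0 → graphPolicy hM σ a = 0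
  · rw [klDiv_toMeasure hac, sum_graphPolicy_mul hM σ fun a x => Real.log (x / (τ a).toReal)]
    refine ENNReal.ofReal_le_ofReal ?_
    have hpos : ∀ i, 0 < (τ (i, σ i)).toReal := fun i =>
      ENNReal.toReal_pos (fun h => by simpa [graphPolicy_apply] using hac _ h) (τ.apply_ne_top _)
    -- Tangent line of `log`, taken where `τ` has the uniform weight `1/(qM)`; it replaces Jensen's
    -- inequality.
    have hlog : ∀ i, Real.log q + 1 - q * M * (τ (i, σ i)).toReal ≤
        Real.log (1 / M / (τ (i, σ i)).toReal) := by
      intro i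
      have := hpos i
      have h := Real.log_le_sub_one_of_pos (show 0 < q * M * (τ (i, σ i)).toReal by positivity)
      rw [show 1 / M / (τ (i, σ i)).toReal = q / (q * M * (τ (i, σ i)).toReal) by field_simp,
        Real.log_div hq0.ne' (by positivity)]
      linarith
    -- The least of `q` weights is at most their average.
    have hsum : q * ∑ i, (τ (i, σ i)).toReal ≤ 1 := by
      rw [← pmf_sum_toReal τ, Fintype.sum_prod_type, Finset.mul_sum]
      refine Finset.sum_le_sum fun i _ => ?_
      have := Finset.sum_le_sum fun (j : Fin q) (_ : j ∈ Finset.univ) => hσ i j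
      simpa using this
    have h1 := Finset.sum_le_sum fun (i : Fin M) (_ : i ∈ Finset.univ) => hlog i
    rw [Finset.sum_sub_distrib, ← Finset.mul_sum] at h1
    simp only [Finset.sum_const, Finset.card_univ, Fintype.card_fin, nsmul_eq_mul] at h1
    rw [one_div, ← div_eq_inv_mul, le_div_iff₀ hM0]
    simp only [← one_div]
    nlinarith
  · push Not at hac
    obtain ⟨a, hτ, hp⟩ := hac
    rw [klDiv_toMeasure_eq_top hτ hp]
    exact le_top

end multiTask

end FixedExperts

/-! ### Structure of the multi-task policies and the regret lower bounds -/

theorem theorem7 (q M K : ℕ) (Θ : Finset (PMF (Fin M × Fin q)))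
    (hq : 2 ≤ q) (hM : 1 ≤ M) (hK : K = q * M)
    (hΘ : Θ = FixedExperts.multiTaskPolicies M q) :
    -- the structure: `K` arms, each played by some policy, and `N = q ^ M` policies
    Fintype.card (Fin M × Fin q) = K ∧ 2 ≤ K ∧
    (∀ a, ∃ θ ∈ Θ, 0 < θ a) ∧
    Θ.card = q ^ M ∧
    -- its information-theoretic quantities; the minimum in `D*(Θ)` is attained
    FixedExperts.SStar Θ = q ∧
    (∃ τ, FixedExperts.maxKL Θ τ = FixedExperts.DStar Θ) ∧
    FixedExperts.DStar Θ = ENNReal.ofReal (Real.log q) ∧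
    FixedExperts.SStar Θ * Real.log Θ.card = K * (FixedExperts.DStar Θ).toReal ∧
    -- the lower bounds for every algorithm, which may depend on the horizon `T`
    (∀ T : ℕ, (K : ℝ) / (4 * Real.log (4 / 3)) ≤ T →
      ∀ π : FixedExperts.Strategy Θ,
        ∃ ℓ : ℕ → Fin M × Fin q → ℝ, (∀ t a, ℓ t a ∈ Set.Icc (0 : ℝ) 1) ∧
          1 / 18 * √((K : ℝ) * T) ≤ FixedExperts.regret π ℓ T ∧
          1 / 18 * √(FixedExperts.SStar Θ * T *
              (Real.log Θ.card / Real.log (FixedExperts.SStar Θ))) ≤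
            FixedExperts.regret π ℓ T) := by
  have hM0 : (0 : ℝ) < M := by exact_mod_cast hM
  have hq2 : (2 : ℝ) ≤ q := by exact_mod_cast hq
  have hKr : (K : ℝ) = q * M := by rw [hK]; push_cast; rfl
  have hlog : 0 < Real.log q := Real.log_pos (by linarith)
  have hne : Nonempty (Fin M × Fin q) := ⟨(⟨0, hM⟩, ⟨0, by omega⟩)⟩
  subst hΘ
  set Θ := FixedExperts.multiTaskPolicies M q with hΘ
  have hpol : ∀ σ, FixedExperts.graphPolicy hM σ ∈ Θ := fun σ =>
    (FixedExperts.mem_multiTaskPolicies hM).2 ⟨σ, rfl⟩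
  have hcard : Θ.card = q ^ M := FixedExperts.card_multiTaskPolicies hM
  have hS : FixedExperts.SStar Θ = q := FixedExperts.SStar_multiTaskPolicies hM hq
  have hD : FixedExperts.DStar Θ = ENNReal.ofReal (Real.log q) :=
    le_antisymm ((iInf_le _ _).trans (FixedExperts.maxKL_uniform_le hM (by omega)))
      (le_iInf (FixedExperts.log_le_maxKL hM (by omega)))
  have hlogN : Real.log (Θ.card : ℝ) = M * Real.log q := by
    rw [hcard]
    push_cast
    rw [Real.log_pow]
  refine ⟨?_, ?_, ?_, hcard, hS, ?_, hD, ?_, ?_⟩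
  · simp [hK, mul_comm]
  · nlinarith
  · intro a
    refine ⟨_, hpol fun _ => a.2, ?_⟩
    simp [FixedExperts.graphPolicy_apply]
  · exact ⟨PMF.uniformOfFintype _, le_antisymm
      ((FixedExperts.maxKL_uniform_le hM (by omega)).trans_eq hD.symm) (iInf_le _ _)⟩
  · rw [hS, hlogN, hD, ENNReal.toReal_ofReal hlog.le, hKr]
    ring
  · intro T hT π
    have hl0 : 0 < Real.log (4 / 3) := Real.log_pos (by norm_num)
    have hT0 : (0 : ℝ) < T := lt_of_lt_of_le (by rw [hKr]; positivity) hT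
    obtain ⟨ε, h0, h1, hgap⟩ := FixedExperts.exists_gap hKr hq2 hM0 hT0 hT
    obtain ⟨ℓ, hℓ, hreg⟩ := FixedExperts.exists_gap_le_regret hM (by omega)
      (fun θ hθ i => FixedExperts.sum_section_toReal hM hθ i)
      (fun σ => ⟨_, hpol σ, fun i => by simp [FixedExperts.graphPolicy_toReal]⟩) π h0 h1
      (by exact_mod_cast hT0)
    have hbound := hgap.trans hreg
    refine ⟨ℓ, hℓ, hbound, ?_⟩
    rw [hS, hlogN]
    -- `log N / log S* = M`, so the second root is again `√(KT)`.
    rwa [show (q : ℝ) * T * (M * Real.log q / Real.log q) = K * T by rw [hKr]; field_simp]
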